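/- Let $K$ be a field of characteristic different from $2$. A superalgebra over $K$ is a (not necessarily associative or unital) $K$-algebra $A$ with a vector space decomposition $A=A_0\oplus A_1$ such that $A_iA_j\subseteq A_{i+j}$ for all $i,j\in\mathbb Z/2$; for $a\in A_i$ write $\overline a=i$. It is called bicommutative if \[ a(bc)=(-1)^{\overline a\,\overline b}\,b(ac)\quad\text{and}\quad (ab)c=(-1)^{\overline b\,\overline c}\,(ac)b \] for all homogeneous $a,b,c\in A$. A super-polynomial is an element $f$ of the free nonassociative (non-unital) $K$-algebra on even variables $y_1,y_2,\ldots$ and odd variables $z_1,z_2,\ldots$; the superalgebra $A$ satisfies the super-identity $f=0$ if $f$ vanishes under every substitution of elements of $A_0$ for the $y_i$ and of elements of $A_1$ for the $z_i$. A variety of superalgebras is the class of all superalgebras over $K$ that satisfy all the super-identities of some given set. Then the variety of all bicommutative superalgebras over $K$ has the Specht property: every variety of superalgebras over $K$ all of whose members are bicommutative can be defined, as a class of superalgebras, by a finite set of super-identities. -/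

import Mathlib

universe u v

/-- A superalgebra over `K`: a (not necessarily associative or unital) `K`-algebra `A` with a
decomposition `A = A_0 ⊕ A_1` into subspaces such that `A_i A_j ⊆ A_{i+j}`, indices mod 2. -/
structure Superalgebra (K : Type u) [Field K] where
  carrier : Type v
  [ring : NonUnitalNonAssocRing carrier]
  [module : Module K carrier]
  [smulCommClass : SMulCommClass K carrier carrier]
  [isScalarTower : IsScalarTower K carrier carrier]
  /-- The even component `component 0` and the odd component `component 1`. -/
  component : ZMod 2 → Submodule K carrier
  isInternal : DirectSum.IsInternal component
  mul_mem : ∀ {i j : ZMod 2} {a b : carrier},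
    a ∈ component i → b ∈ component j → a * b ∈ component (i + j)

namespace Superalgebra

attribute [instance] ring module smulCommClass isScalarTower

/-- Free generators: `(0, n)` is the `n`-th even variable, `(1, n)` is the `n`-th odd variable. -/
abbrev Var : Type := ZMod 2 × ℕ

/-- Super-polynomials: elements of the free nonassociative algebra (without unit) on countably
many even and countably many odd variables. -/
abbrev SuperPoly (K : Type u) [Field K] : Type u :=
  FreeNonUnitalNonAssocAlgebra K Var

variable {K : Type u} [Field K]

/-- `f = 0` is a super-identity of `A`: `f` vanishes whenever its even variables are replaced by
even elements of `A` and its odd variables by odd elements of `A`. -/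
def Satisfies (A : Superalgebra.{u, v} K) (f : SuperPoly K) : Prop :=
  ∀ φ : Var → A.carrier, (∀ x : Var, φ x ∈ A.component x.1) →
    FreeNonUnitalNonAssocAlgebra.lift K φ f = 0

/-- The class of all superalgebras that satisfy the super-identities `f = 0`, `f ∈ S`. -/
def definedBy (S : Set (SuperPoly K)) : Set (Superalgebra.{u, v} K) :=
  {A | ∀ f ∈ S, A.Satisfies f}

/-- A variety of superalgebras: a class defined by some set of super-identities. -/
def IsVariety (V : Set (Superalgebra.{u, v} K)) : Prop :=
  ∃ S : Set (SuperPoly K), V = definedBy S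

/-- The class `V` is defined by finitely many super-identities. -/
def IsFinitelyBased (V : Set (Superalgebra.{u, v} K)) : Prop :=
  ∃ S : Set (SuperPoly K), S.Finite ∧ V = definedBy S

/-- Super-left-commutativity and super-right-commutativity, for homogeneous elements. -/
def IsBicommutative (A : Superalgebra.{u, v} K) : Prop :=
  ∀ (i j k : ZMod 2) (a b c : A.carrier),
    a ∈ A.component i → b ∈ A.component j → c ∈ A.component k →
      a * (b * c) = (-1 : K) ^ (i.val * j.val) • (b * (a * c)) ∧
      (a * b) * c = (-1 : K) ^ (j.val * k.val) • ((a * c) * b)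

/-- The class of all bicommutative superalgebras over `K`. -/
def bicommutative (K : Type u) [Field K] : Set (Superalgebra.{u, v} K) :=
  {A | A.IsBicommutative}

end Superalgebra

/-!
A class `V` of bicommutative superalgebras is determined by its super-identities, and it is enough
to show that all of them follow from finitely many. The argument is a Gröbner basis argument for
combinations of nonassociative monomials, stable under renaming of variables.

Up to signs, a monomial is evaluated in a bicommutative superalgebra as in a *bicommutative magma*,
where `a(bc) = b(ac)` and `(ab)c = (ac)b`. In such a magma left multiplications also commute with
right multiplications on products (`BicommutativeMagma.mul_mul_mul_eq`). Hence the value of a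
monomial depends only on two multisets of variables, those that act from the left and those that
act from the right (`map_eq_of_factors_eq`). Applied to the congruence `Superalgebra.signCon`, this
shows that modulo the identities of bicommutative superalgebras every super-polynomial is a
combination of representatives, one for each pair of multisets. The representatives need not be
linearly independent, so no model of the free bicommutative superalgebra is needed: the identities
of `V` are pulled back to the free vector space on the set of pairs of multisets
(`Superalgebra.normalIdentities`).

Pairs of multisets are well-ordered by degree and then lexicographically. Multiplying by a variable
and renaming the variables by a strictly increasing map of the indices preserve identities, are
strictly monotone for this order, and send representatives to representatives up to sign and up to
bicommutative identities (`Superalgebra.IsMonomialOperator.exists_stableMap`). By Higman's lemma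
(`Superalgebra.wellQuasiOrdered_shift`) these operations well-quasi-order the pairs of multisets.
Thus finitely many identities of `V` have leading monomials from which all other leading monomials
of identities of `V` are obtained, and reduction of leading terms, which needs no homogeneity and no
assumption on the size of `K`, shows that they generate the rest (`exists_finite_generating`).
Together with the finitely many identities that define bicommutativity they define `V`.
-/

/-! ### Leading terms in a free module -/

section LeadingTerms

variable {K N : Type*} [Field K]

/-- The linear map on the free module with basis `N` that sends the basis vector `n` to `c n` times
the basis vector `τ n`. -/
noncomputable def monomialMap (τ : N → N) (c : N → K) : (N →₀ K) →ₗ[K] (N →₀ K) :=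
  Finsupp.linearCombination K fun n => c n • Finsupp.single (τ n) 1

lemma monomialMap_single (τ : N → N) (c : N → K) (n : N) (a : K) :
    monomialMap τ c (Finsupp.single n a) = Finsupp.single (τ n) (a * c n) := by
  simp [monomialMap]

lemma monomialMap_apply {τ : N → N} (hτ : Function.Injective τ) (c : N → K) (f : N →₀ K) (n : N) :
    monomialMap τ c f (τ n) = f n * c n := by
  induction f using Finsupp.induction_linear with
  | zero => simp
  | add f g hf hg => simp [hf, hg, add_mul]
  | single m a =>
    rw [monomialMap_single]
    by_cases h : m = n
    · simp [h]
    · rw [Finsupp.single_eq_of_ne' (hτ.ne h), Finsupp.single_eq_of_ne' h, zero_mul]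

lemma exists_of_monomialMap_apply_ne_zero {τ : N → N} {c : N → K} {f : N →₀ K} {k : N}
    (h : monomialMap τ c f k ≠ 0) : ∃ m, f m ≠ 0 ∧ τ m = k := by
  by_contra! H
  apply h
  rw [monomialMap, Finsupp.linearCombination_apply, Finsupp.sum, Finsupp.finsetSum_apply]
  refine Finset.sum_eq_zero fun m hm => ?_
  simp [Finsupp.single_eq_of_ne' (H m (Finsupp.mem_support_iff.1 hm))]

lemma exists_finite_dominating {r : N → N → Prop} (hr : WellQuasiOrdered r) (P : N → Prop) :
    ∃ B : Finset N, (∀ b ∈ B, P b) ∧ ∀ n, P n → ∃ b ∈ B, r b n := by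
  by_contra! H
  obtain ⟨f, -, hf⟩ := exists_seq_of_forall_finset_exists P (fun x y => ¬ r x y) fun s hs => H s hs
  obtain ⟨m, n, hmn, h⟩ := hr f
  exact hf m n hmn h

variable [LinearOrder N] [WellFoundedLT N]

/-- Equivariant Hilbert basis theorem by leading terms. Let `𝒯` be a set of monomial maps that are
strictly monotone on the well-ordered basis `N`, and let `N` be well-quasi-ordered by `𝒯`. A
subspace stable under `𝒯` then has a finite subset which lies in no smaller stable subspace. -/
theorem exists_finite_generating (𝒯 : Set ((N → N) × (N → K)))
    (hmono : ∀ T ∈ 𝒯, StrictMono T.1) (hne : ∀ T ∈ 𝒯, ∀ n, T.2 n ≠ 0)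
    (hwqo : WellQuasiOrdered fun m n => ∃ T ∈ 𝒯, T.1 m = n)
    (J : Submodule K (N →₀ K)) (hJ : ∀ T ∈ 𝒯, ∀ f ∈ J, monomialMap T.1 T.2 f ∈ J) :
    ∃ G : Set (N →₀ K), G.Finite ∧ G ⊆ J ∧ ∀ J' : Submodule K (N →₀ K),
      (∀ T ∈ 𝒯, ∀ f ∈ J', monomialMap T.1 T.2 f ∈ J') → G ⊆ J' → J ≤ J' := by
  classical
  obtain ⟨B, hB, hdom⟩ := exists_finite_dominating hwqo
    fun n => ∃ f ∈ J, f n ≠ 0 ∧ ∀ k, f k ≠ 0 → k ≤ n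
  choose! g hgJ hgne hgle using hB
  refine ⟨g '' B, B.finite_toSet.image g, Set.image_subset_iff.2 hgJ, fun J' hJ' hG => ?_⟩
  have key : ∀ n, ∀ f ∈ J, (∀ k, f k ≠ 0 → k ≤ n) → f ∈ J' := by
    intro n
    induction n using WellFoundedLT.induction with
    | ind n ih =>
      -- The induction hypothesis covers the elements whose leading monomial is below `n`.
      have low : ∀ f ∈ J, (∀ k, f k ≠ 0 → k < n) → f ∈ J' := by
        intro f hf hlt
        by_cases h0 : f = 0
        · rw [h0]
          exact J'.zero_mem
        have hs : f.support.Nonempty := Finsupp.support_nonempty_iff.2 h0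
        exact ih (f.support.max' hs)
          (hlt _ (Finsupp.mem_support_iff.1 (f.support.max'_mem hs))) f hf
          fun k hk => f.support.le_max' k (Finsupp.mem_support_iff.2 hk)
      intro f hf hle
      by_cases hn : f n = 0
      · exact low f hf fun k hk => lt_of_le_of_ne (hle k hk) fun h => hk (h ▸ hn)
      obtain ⟨b, hb, T, hT, rfl⟩ := hdom n ⟨f, hf, hn, hle⟩
      set h := monomialMap T.1 T.2 (g b) with hh
      have hlead : h (T.1 b) = g b b * T.2 b := monomialMap_apply (hmono T hT).injective _ _ _
      have hlead0 : h (T.1 b) ≠ 0 := hlead ▸ mul_ne_zero (hgne b hb) (hne T hT b)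
      have hhJ : h ∈ J := hJ T hT _ (hgJ b hb)
      have hhJ' : h ∈ J' := hJ' T hT _ (hG ⟨b, hb, rfl⟩)
      have hhle : ∀ k, h k ≠ 0 → k ≤ T.1 b := by
        intro k hk
        obtain ⟨m, hm, rfl⟩ := exists_of_monomialMap_apply_ne_zero hk
        exact (hmono T hT).monotone (hgle b hb m hm)
      have hsub : f - (f (T.1 b) / h (T.1 b)) • h ∈ J' := by
        refine low _ (J.sub_mem hf (J.smul_mem _ hhJ)) fun k hk => lt_of_le_of_ne ?_ ?_
        · by_contra hlt
          refine hk ?_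
          have h1 : f k = 0 := by_contra fun h => hlt (hle k h)
          have h2 : h k = 0 := by_contra fun h => hlt (hhle k h)
          simp [h1, h2]
        · rintro rfl
          exact hk (by simp [hlead0])
      simpa using J'.add_mem hsub (J'.smul_mem (f (T.1 b) / h (T.1 b)) hhJ')
  intro f hf
  by_cases h0 : f = 0
  · rw [h0]
    exact J'.zero_mem
  have hs : f.support.Nonempty := Finsupp.support_nonempty_iff.2 h0
  exact key (f.support.max' hs) f hf fun k hk => f.support.le_max' k (Finsupp.mem_support_iff.2 hk)

end LeadingTerms

/-! ### Bicommutative magmas -/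

section Magma

/-- A magma with commuting left multiplications and commuting right multiplications. -/
class BicommutativeMagma (Q : Type*) extends Mul Q where
  left_comm : ∀ a b c : Q, a * (b * c) = b * (a * c)
  right_comm : ∀ a b c : Q, (a * b) * c = (a * c) * b

namespace BicommutativeMagma

variable {X Q : Type*} [BicommutativeMagma Q]

/-- On products, left multiplications commute with right multiplications. -/
lemma mul_mul_mul_eq (a b c d : Q) : a * ((b * c) * d) = (a * (b * c)) * d := by
  calc a * ((b * c) * d) = a * ((b * d) * c) := by rw [right_comm b c d]
    _ = (b * d) * (a * c) := left_comm _ _ _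
    _ = (b * (a * c)) * d := right_comm _ _ _
    _ = (a * (b * c)) * d := by rw [left_comm b a c]

variable (g : X → Q)

instance : LeftCommutative fun (x : X) (q : Q) => g x * q :=
  ⟨fun _ _ _ => left_comm _ _ _⟩

instance : LeftCommutative fun (x : X) (q : Q) => q * g x :=
  ⟨fun _ _ _ => right_comm _ _ _⟩

/-- Apply to `p` the right multiplications by the elements of `r`. -/
def mulRight (p : Q) (r : Multiset X) : Q := r.foldr (fun x q => q * g x) p

/-- Apply to `p` the left multiplications by the elements of `l`. -/
def mulLeft (p : Q) (l : Multiset X) : Q := l.foldr (fun x q => g x * q) p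

lemma mulRight_cons (p : Q) (x : X) (r : Multiset X) :
    mulRight g p (x ::ₘ r) = mulRight g p r * g x := Multiset.foldr_cons ..

lemma mulLeft_cons (p : Q) (x : X) (l : Multiset X) :
    mulLeft g p (x ::ₘ l) = g x * mulLeft g p l := Multiset.foldr_cons ..

lemma mulRight_add (p : Q) (r s : Multiset X) :
    mulRight g p (r + s) = mulRight g (mulRight g p s) r := Multiset.foldr_add ..

lemma mulLeft_add (p : Q) (r s : Multiset X) :
    mulLeft g p (r + s) = mulLeft g (mulLeft g p s) r := Multiset.foldr_add ..

lemma mulRight_mul_right (p : Q) (x : X) (r : Multiset X) :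
    mulRight g (p * g x) r = mulRight g p r * g x := by
  rw [← mulRight_cons, ← Multiset.singleton_add, add_comm, mulRight_add]
  rfl

lemma mulLeft_mul_left (p : Q) (x : X) (l : Multiset X) :
    mulLeft g (g x * p) l = g x * mulLeft g p l := by
  rw [← mulLeft_cons, ← Multiset.singleton_add, add_comm, mulLeft_add]
  rfl

lemma exists_mul_eq_mulRight (a b : Q) (r : Multiset X) :
    ∃ c d, mulRight g (a * b) r = c * d := by
  induction r using Multiset.induction with
  | empty => exact ⟨a, b, rfl⟩
  | cons x r ih => exact ⟨_, _, mulRight_cons ..⟩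

lemma exists_mul_eq_mulLeft (a b : Q) (l : Multiset X) :
    ∃ c d, mulLeft g (a * b) l = c * d := by
  induction l using Multiset.induction with
  | empty => exact ⟨a, b, rfl⟩
  | cons x r ih => exact ⟨_, _, mulLeft_cons ..⟩

lemma mul_mulLeft (u p : Q) (l : Multiset X) : u * mulLeft g p l = mulLeft g (u * p) l := by
  induction l using Multiset.induction with
  | empty => rfl
  | cons x l ih => rw [mulLeft_cons, mulLeft_cons, left_comm, ih]

lemma mul_mulRight (u a b : Q) (r : Multiset X) :
    u * mulRight g (a * b) r = mulRight g (u * (a * b)) r := by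
  induction r using Multiset.induction with
  | empty => rfl
  | cons x r ih =>
    obtain ⟨c, d, h⟩ := exists_mul_eq_mulRight g a b r
    rw [mulRight_cons, mulRight_cons, ← ih, h, mul_mul_mul_eq]

lemma mulLeft_mulRight (a b : Q) (l r : Multiset X) :
    mulLeft g (mulRight g (a * b) r) l = mulRight g (mulLeft g (a * b) l) r := by
  induction l using Multiset.induction with
  | empty => rfl
  | cons x l ih =>
    obtain ⟨c, d, h⟩ := exists_mul_eq_mulLeft g a b l
    rw [mulLeft_cons, mulLeft_cons, ih, h, mul_mulRight]

/-- The product with left factors `a` and `l` and with right factors `b` and `r`. -/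
def normalForm (a b : X) (l r : Multiset X) : Q := mulLeft g (mulRight g (g a * g b) r) l

lemma mul_normalForm (x a b : X) (l r : Multiset X) :
    g x * normalForm g a b l r = normalForm g a b (x ::ₘ l) r := (mulLeft_cons ..).symm

lemma normalForm_mul (x a b : X) (l r : Multiset X) :
    normalForm g a b l r * g x = normalForm g a b l (x ::ₘ r) := by
  rw [normalForm, normalForm, mulLeft_mulRight, mulLeft_mulRight, mulRight_cons]

lemma normalForm_swap_left (a b x : X) (l r : Multiset X) :
    normalForm g a b (x ::ₘ l) r = normalForm g x b (a ::ₘ l) r := by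
  simp only [normalForm, mulLeft_cons, ← mulLeft_mul_left, mul_mulRight, left_comm (g x) (g a)]

lemma normalForm_swap_right (a b x : X) (l r : Multiset X) :
    normalForm g a b l (x ::ₘ r) = normalForm g a x l (b ::ₘ r) := by
  simp only [normalForm, mulRight_cons, ← mulRight_mul_right, right_comm (g a) (g b)]

/-- A normal form depends only on the multisets of its left and of its right factors. -/
lemma normalForm_congr {a b a' b' : X} {l r l' r' : Multiset X} (hl : a ::ₘ l = a' ::ₘ l')
    (hr : b ::ₘ r = b' ::ₘ r') : normalForm g a b l r = normalForm g a' b' l' r' := by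
  have h1 : normalForm g a b l r = normalForm g a' b l' r := by
    rcases Multiset.cons_eq_cons.1 hl with ⟨rfl, rfl⟩ | ⟨-, s, rfl, rfl⟩
    · rfl
    · exact normalForm_swap_left ..
  rw [h1]
  rcases Multiset.cons_eq_cons.1 hr with ⟨rfl, rfl⟩ | ⟨-, s, rfl, rfl⟩
  · rfl
  · exact normalForm_swap_right ..

lemma mulLeft_normalForm (a b : X) (l r s : Multiset X) :
    mulLeft g (normalForm g a b l r) s = normalForm g a b (s + l) r := (mulLeft_add ..).symm

lemma mulRight_normalForm (a b : X) (l r s : Multiset X) :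
    mulRight g (normalForm g a b l r) s = normalForm g a b l (s + r) := by
  obtain ⟨c, d, h⟩ := exists_mul_eq_mulRight g (g a) (g b) r
  rw [normalForm, normalForm, mulRight_add, h, mulLeft_mulRight]

lemma normalForm_mul_normalForm (a b a' b' : X) (l r l' r' : Multiset X) :
    normalForm g a b l r * normalForm g a' b' l' r' =
      normalForm g a b (l' + a' ::ₘ l) (r' + b' ::ₘ r) := by
  have h : normalForm g a b l r * (g a' * g b') = normalForm g a b (a' ::ₘ l) (b' ::ₘ r) := by
    rw [left_comm, normalForm_mul, mul_normalForm]
  rw [normalForm.eq_1 g a' b' l' r', mul_mulLeft, mul_mulRight, h, mulRight_normalForm,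
    mulLeft_normalForm]

end BicommutativeMagma

/-- The left and the right factors of a product that is not a generator; the generator `x` counts
as a right factor. -/
def factors {X : Type*} : FreeMagma X → Multiset X × Multiset X
  | .of x => (0, {x})
  | .mul (.of x) v => ({x}, 0) + factors v
  | .mul (.mul u u') v => factors (.mul u u') + factors v

/-- The factors that `u` contributes to a product `u * v`: a generator becomes a left factor. -/
def leftFactors {X : Type*} : FreeMagma X → Multiset X × Multiset X
  | .of x => ({x}, 0)
  | .mul u v => factors (.mul u v)

variable {X Q : Type*}

lemma factors_of (x : X) : factors (.of x) = (0, {x}) := by rw [factors]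

lemma leftFactors_of (x : X) : leftFactors (.of x) = ({x}, 0) := rfl

lemma leftFactors_mul (u v : FreeMagma X) : leftFactors (u * v) = factors (u * v) := rfl

lemma factors_mul (u v : FreeMagma X) : factors (u * v) = leftFactors u + factors v := by
  cases u
  · exact factors.eq_2 ..
  · exact factors.eq_3 ..

open BicommutativeMagma in
/-- Every product of at least two generators has a normal form, whose factors are those recorded by
`factors`. -/
lemma exists_normalForm [BicommutativeMagma Q] (e : FreeMagma X →ₙ* Q) (w : FreeMagma X) :
    (∃ x, w = .of x) ∨ ∃ a b l r, e w = normalForm (fun x => e (.of x)) a b l r ∧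
      factors w = (a ::ₘ l, b ::ₘ r) ∧ leftFactors w = factors w := by
  induction w with
  | ih1 x => exact .inl ⟨x, rfl⟩
  | ih2 u v ihu ihv =>
    right
    simp only [factors_mul, leftFactors_mul, map_mul]
    rcases ihu with ⟨x, rfl⟩ | ⟨a, b, l, r, hu, hu', hu''⟩ <;>
      rcases ihv with ⟨y, rfl⟩ | ⟨a', b', l', r', hv, hv', -⟩
    · exact ⟨x, y, 0, 0, rfl, by simp [leftFactors_of, factors_of], trivial⟩
    · refine ⟨a', b', x ::ₘ l', r', by rw [hv, ← mul_normalForm], ?_, trivial⟩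
      simp [leftFactors_of, hv', Multiset.cons_swap]
    · refine ⟨a, b, l, y ::ₘ r, by rw [hu, ← normalForm_mul], ?_, trivial⟩
      simp [factors_of, hu', hu'', add_comm r]
    · refine ⟨a, b, l' + a' ::ₘ l, r' + b' ::ₘ r, by rw [hu, hv, normalForm_mul_normalForm], ?_,
        trivial⟩
      simp only [hu', hu'', hv', Prod.mk_add_mk, ← Multiset.singleton_add, Prod.mk.injEq]
      constructor <;> abel

open BicommutativeMagma in
/-- Two products of generators with the same factors agree in every bicommutative magma. -/
theorem map_eq_of_factors_eq [BicommutativeMagma Q] (e : FreeMagma X →ₙ* Q) {w w' : FreeMagma X}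
    (h : factors w = factors w') : e w = e w' := by
  rcases exists_normalForm e w with ⟨x, rfl⟩ | ⟨a, b, l, r, hw, hf, -⟩ <;>
    rcases exists_normalForm e w' with ⟨y, rfl⟩ | ⟨a', b', l', r', hw', hf', -⟩
  · simp only [factors_of, Prod.mk.injEq, Multiset.singleton_inj, true_and] at h
    rw [h]
  · simp [factors_of, hf'] at h
  · simp [factors_of, hf] at h
  · rw [hf, hf', Prod.mk.injEq] at h
    rw [hw, hw', normalForm_congr _ h.1 h.2]

end Magma

/-! ### A monomial order -/

lemma toLex_toFinsupp_map_lt {α β : Type*} [LinearOrder α] [LinearOrder β] {f : α → β}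
    (hf : StrictMono f) {s t : Multiset α}
    (h : toLex (Multiset.toFinsupp s) < toLex (Multiset.toFinsupp t)) :
    toLex (Multiset.toFinsupp (s.map f)) < toLex (Multiset.toFinsupp (t.map f)) := by
  rw [Finsupp.Lex.lt_iff] at h ⊢
  simp only [ofLex_toLex, Multiset.toFinsupp_apply] at h ⊢
  obtain ⟨i, hlt, hi⟩ := h
  refine ⟨f i, fun j hj => ?_, ?_⟩
  · by_cases hjr : ∃ k, f k = j
    · obtain ⟨k, rfl⟩ := hjr
      rw [Multiset.count_map_eq_count' _ _ hf.injective, Multiset.count_map_eq_count' _ _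
        hf.injective, hlt k (hf.lt_iff_lt.1 hj)]
    · rw [Multiset.count_eq_zero_of_notMem, Multiset.count_eq_zero_of_notMem] <;>
      · rw [Multiset.mem_map]
        exact fun ⟨k, _, hk⟩ => hjr ⟨k, hk⟩
  · rwa [Multiset.count_map_eq_count' _ _ hf.injective, Multiset.count_map_eq_count' _ _
      hf.injective]

lemma card_leftFactors_fst_pos {X : Type*} (w : FreeMagma X) : 0 < (leftFactors w).1.card := by
  induction w with
  | ih1 x => simp [leftFactors_of]
  | ih2 u v ihu _ =>
    rw [leftFactors_mul, factors_mul, Prod.fst_add, Multiset.card_add]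
    omega

lemma card_factors_snd_pos {X : Type*} (w : FreeMagma X) : 0 < (factors w).2.card := by
  induction w with
  | ih1 x => simp [factors_of]
  | ih2 u v _ ihv =>
    rw [factors_mul, Prod.snd_add, Multiset.card_add]
    omega

lemma factors_map {X Y : Type*} (f : X → Y) (w : FreeMagma X) :
    factors (FreeMagma.map f w) = ((factors w).1.map f, (factors w).2.map f) ∧
    leftFactors (FreeMagma.map f w) = ((leftFactors w).1.map f, (leftFactors w).2.map f) := by
  induction w with
  | ih1 x => simp [factors_of, leftFactors_of]
  | ih2 u v ihu ihv =>
    simp [map_mul, leftFactors_mul, factors_mul, ihu, ihv]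

namespace Superalgebra

/-- The position of a variable in the order used to compare monomials. The order is reversed, so
that the largest variable, rather than the smallest, decides a lexicographic comparison: this makes
the lexicographic order on monomials in infinitely many variables well-founded. -/
def varKey (x : Var) : (ℕ ×ₗ ℕ)ᵒᵈ := OrderDual.toDual (toLex (x.1.val, x.2))

lemma varKey_injective : Function.Injective varKey := by
  rintro ⟨p, i⟩ ⟨q, j⟩ h
  have h' : (p.val, i) = (q.val, j) := h
  rw [Prod.mk.injEq] at h'
  rw [ZMod.val_injective 2 h'.1, h'.2]

/-- A multiset of variables as an element of the lexicographically ordered monoid of monomials. -/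
noncomputable def lexWeight (s : Multiset Var) : Lex ((ℕ ×ₗ ℕ)ᵒᵈ →₀ ℕ) :=
  toLex (Multiset.toFinsupp (s.map varKey))

lemma lexWeight_add (s t : Multiset Var) : lexWeight (s + t) = lexWeight s + lexWeight t := by
  simp [lexWeight]

lemma lexWeight_injective : Function.Injective lexWeight := fun _ _ h =>
  Multiset.map_injective varKey_injective (Multiset.toFinsupp.injective (toLex.injective h))

/-- Pairs of multisets are ordered by total size, ties being broken lexicographically. -/
noncomputable def weight (p : Multiset Var × Multiset Var) :
    ℕ ×ₗ (Lex ((ℕ ×ₗ ℕ)ᵒᵈ →₀ ℕ) ×ₗ Lex ((ℕ ×ₗ ℕ)ᵒᵈ →₀ ℕ)) :=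
  toLex (p.1.card + p.2.card, toLex (lexWeight p.1, lexWeight p.2))

lemma weight_add (p q : Multiset Var × Multiset Var) : weight (p + q) = weight p + weight q := by
  simp only [weight, Prod.fst_add, Prod.snd_add, Multiset.card_add, lexWeight_add, ← toLex_add,
    Prod.mk_add_mk]
  rw [add_add_add_comm]

lemma weight_injective : Function.Injective weight := by
  rintro ⟨a, b⟩ ⟨c, d⟩ h
  simp only [weight, EmbeddingLike.apply_eq_iff_eq, Prod.mk.injEq] at h
  rw [lexWeight_injective h.2.1, lexWeight_injective h.2.2]

lemma weight_lt_iff {p q : Multiset Var × Multiset Var} : weight p < weight q ↔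
    p.1.card + p.2.card < q.1.card + q.2.card ∨ p.1.card + p.2.card = q.1.card + q.2.card ∧
      (lexWeight p.1 < lexWeight q.1 ∨ lexWeight p.1 = lexWeight q.1 ∧
        lexWeight p.2 < lexWeight q.2) := by
  simp only [weight, Prod.Lex.toLex_lt_toLex]

/-- The renaming of variables by a map of the indices, which keeps parities. -/
def shift (ρ : ℕ → ℕ) (x : Var) : Var := (x.1, ρ x.2)

lemma shift_injective {ρ : ℕ → ℕ} (hρ : StrictMono ρ) : Function.Injective (shift ρ) :=
  Prod.map_injective.2 ⟨Function.injective_id, hρ.injective⟩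

lemma lexWeight_map_shift_lt {ρ : ℕ → ℕ} (hρ : StrictMono ρ) {s t : Multiset Var}
    (h : lexWeight s < lexWeight t) :
    lexWeight (s.map (shift ρ)) < lexWeight (t.map (shift ρ)) := by
  let f : ℕ ×ₗ ℕ → ℕ ×ₗ ℕ := fun x => toLex ((ofLex x).1, ρ (ofLex x).2)
  have hf : StrictMono f := by
    intro x y hxy
    rw [Prod.Lex.lt_iff] at hxy ⊢
    exact hxy.imp_right fun h => ⟨h.1, hρ h.2⟩
  have hcomm : ∀ s : Multiset Var, (s.map (shift ρ)).map varKey = (s.map varKey).map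
      (OrderDual.toDual ∘ f ∘ OrderDual.ofDual) := by
    intro s
    rw [Multiset.map_map, Multiset.map_map]
    rfl
  rw [lexWeight, lexWeight, hcomm, hcomm]
  exact toLex_toFinsupp_map_lt hf.dual h

/-- The operations on monomials under which leading terms are compared: an order-preserving renaming
of the variables, followed by multiplications by variables. -/
inductive IsMonomialOperator : (FreeMagma Var → FreeMagma Var) → Prop
  | map (ρ : ℕ → ℕ) (hρ : StrictMono ρ) : IsMonomialOperator (FreeMagma.map (shift ρ))
  | mul_left (x : Var) {t} (ht : IsMonomialOperator t) :
      IsMonomialOperator fun w => .of x * t w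
  | mul_right (x : Var) {t} (ht : IsMonomialOperator t) :
      IsMonomialOperator fun w => t w * .of x

lemma weight_map_shift_lt {ρ : ℕ → ℕ} (hρ : StrictMono ρ) {w w' : FreeMagma Var}
    (h : weight (factors w) < weight (factors w')) :
    weight (factors (FreeMagma.map (shift ρ) w)) <
      weight (factors (FreeMagma.map (shift ρ) w')) := by
  rw [weight_lt_iff] at h ⊢
  rw [(factors_map (shift ρ) w).1, (factors_map (shift ρ) w').1]
  simp only [Multiset.card_map]
  refine h.imp_right fun h => ⟨h.1, h.2.imp (lexWeight_map_shift_lt hρ) fun h => ⟨?_, ?_⟩⟩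
  · rw [lexWeight_injective h.1]
  · exact lexWeight_map_shift_lt hρ h.2

/-- Right multiplication turns a generator into a left factor. This does not disturb the order, as
generators are the only monomials of degree one and hence lie below all products. -/
lemma weight_leftFactors_lt {w w' : FreeMagma Var} (h : weight (factors w) < weight (factors w')) :
    weight (leftFactors w) < weight (leftFactors w') := by
  have hcard : ∀ u v : FreeMagma Var, 1 < (factors (u * v)).1.card + (factors (u * v)).2.card := by
    intro u v
    have h1 := card_leftFactors_fst_pos u
    have h2 := card_factors_snd_pos v
    simp only [factors_mul, Prod.fst_add, Prod.snd_add, Multiset.card_add]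
    omega
  induction w with
  | ih1 x =>
    induction w' with
    | ih1 y =>
      rw [weight_lt_iff] at h ⊢
      simpa [factors_of, leftFactors_of] using h
    | ih2 u v _ _ =>
      rw [weight_lt_iff, leftFactors_of, leftFactors_mul]
      exact .inl (by simpa using hcard u v)
  | ih2 u v _ _ =>
    induction w' with
    | ih1 y =>
      have := hcard u v
      rw [weight_lt_iff, factors_of] at h
      simp only [Multiset.card_zero, Multiset.card_singleton] at h
      omega
    | ih2 u' v' _ _ => exact h

lemma IsMonomialOperator.weight_lt {t : FreeMagma Var → FreeMagma Var} (ht : IsMonomialOperator t)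
    {w w' : FreeMagma Var} (h : weight (factors w) < weight (factors w')) :
    weight (factors (t w)) < weight (factors (t w')) := by
  induction ht with
  | map ρ hρ => exact weight_map_shift_lt hρ h
  | mul_left x ht ih =>
    simp only [factors_mul, weight_add]
    exact add_lt_add_right ih _
  | mul_right x ht ih =>
    simp only [factors_mul, weight_add]
    exact add_lt_add_left (weight_leftFactors_lt ih) _

/-! ### Higman's lemma -/

/-- The multiplicities in a pair of multisets of the variables with index `i`. -/
def multiplicities (p : Multiset Var × Multiset Var) (i : ℕ) : ZMod 2 → ℕ × ℕ :=
  fun c => (p.1.count (c, i), p.2.count (c, i))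

/-- Higman's lemma: pairs of multisets of variables are well-quasi-ordered by inclusion up to an
order-preserving renaming of the variables. -/
theorem wellQuasiOrdered_shift :
    WellQuasiOrdered fun p q : Multiset Var × Multiset Var =>
      ∃ ρ : ℕ → ℕ, StrictMono ρ ∧ p.1.map (shift ρ) ≤ q.1 ∧ p.2.map (shift ρ) ≤ q.2 := by
  intro s
  -- A pair of multisets is encoded as a word whose `i`-th letter records the multiplicities of the
  -- variables with index `i`; a subword embedding yields the renaming of the indices.
  let bound : Multiset Var × Multiset Var → ℕ := fun p => (p.1 + p.2).toFinset.sup Prod.snd + 1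
  have hbound : ∀ p i, bound p ≤ i → ∀ c, multiplicities p i c = 0 := by
    intro p i hi c
    have : ((c, i) : Var) ∉ p.1 + p.2 := by
      intro hmem
      have : i ≤ _ := Finset.le_sup (f := Prod.snd) (Multiset.mem_toFinset.2 hmem)
      simp only [bound] at hi
      omega
    rw [Multiset.mem_add, not_or] at this
    simp [multiplicities, Multiset.count_eq_zero_of_notMem this.1,
      Multiset.count_eq_zero_of_notMem this.2]
  let word : Multiset Var × Multiset Var → List (ZMod 2 → ℕ × ℕ) :=
    fun p => (List.range (bound p)).map (multiplicities p)
  have hpwo := Set.PartiallyWellOrderedOn.partiallyWellOrderedOn_sublistForall₂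
    (· ≤ · : (ZMod 2 → ℕ × ℕ) → _ → Prop)
    (Set.isPWO_of_wellQuasiOrderedLE (Set.univ : Set (ZMod 2 → ℕ × ℕ)))
  obtain ⟨m, n, hmn, h⟩ := hpwo.exists_lt (f := fun k => word (s k)) (by simp)
  refine ⟨m, n, hmn, ?_⟩
  obtain ⟨l, hl, hsub⟩ := List.sublistForall₂_iff.1 h
  obtain ⟨ρ, hρ⟩ := List.sublist_iff_exists_orderEmbedding_getElem?_eq.1 hsub
  have hle : ∀ i, multiplicities (s m) i ≤ multiplicities (s n) (ρ i) := by
    intro i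
    by_cases hi : i < bound (s m)
    · have hi1 : i < (word (s m)).length := by simpa [word] using hi
      have hi2 : i < l.length := hl.length_eq ▸ hi1
      have h1 : (word (s m))[i] ≤ l[i] := (List.forall₂_iff_get.1 hl).2 i hi1 hi2
      have h2 := hρ i
      rw [List.getElem?_eq_getElem hi2, eq_comm, List.getElem?_eq_some_iff] at h2
      obtain ⟨h3, h4⟩ := h2
      rw [← h4] at h1
      simpa [word] using h1
    · intro c
      rw [hbound _ _ (not_lt.1 hi)]
      exact zero_le
  have hcount : ∀ a b : Multiset Var, (∀ x, a.count x ≤ b.count (shift ρ x)) →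
      a.map (shift ρ) ≤ b := by
    intro a b hab
    rw [Multiset.le_iff_count]
    intro y
    by_cases hy : y ∈ a.map (shift ρ)
    · obtain ⟨x, -, rfl⟩ := Multiset.mem_map.1 hy
      rw [Multiset.count_map_eq_count' _ _ (shift_injective ρ.strictMono)]
      exact hab x
    · rw [Multiset.count_eq_zero_of_notMem hy]
      exact Nat.zero_le _
  exact ⟨ρ, ρ.strictMono, hcount _ _ fun x => (hle x.2 x.1).1, hcount _ _ fun x => (hle x.2 x.1).2⟩

lemma IsMonomialOperator.exists_add_left {t : FreeMagma Var → FreeMagma Var}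
    (ht : IsMonomialOperator t) (w : FreeMagma Var) (l : Multiset Var) :
    ∃ t', IsMonomialOperator t' ∧ factors (t' w) = (l, 0) + factors (t w) ∧
      (l ≠ 0 ∨ leftFactors (t w) = factors (t w) → leftFactors (t' w) = factors (t' w)) := by
  induction l using Multiset.induction with
  | empty => exact ⟨t, ht, by simp [← Prod.zero_eq_mk], by simp⟩
  | cons x l ih =>
    obtain ⟨t', ht', h, -⟩ := ih
    refine ⟨_, ht'.mul_left x, ?_, fun _ => rfl⟩
    rw [factors_mul, leftFactors_of, h, ← add_assoc]
    simp

lemma IsMonomialOperator.exists_add_right {t : FreeMagma Var → FreeMagma Var}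
    (ht : IsMonomialOperator t) {w : FreeMagma Var} (hw : leftFactors (t w) = factors (t w))
    (r : Multiset Var) :
    ∃ t', IsMonomialOperator t' ∧ factors (t' w) = (0, r) + factors (t w) ∧
      leftFactors (t' w) = factors (t' w) := by
  induction r using Multiset.induction with
  | empty => exact ⟨t, ht, by simp [← Prod.zero_eq_mk], hw⟩
  | cons x r ih =>
    obtain ⟨t', ht', h, h'⟩ := ih
    refine ⟨_, ht'.mul_right x, ?_, rfl⟩
    rw [factors_mul, factors_of, h', h, add_comm, ← add_assoc]
    simp

/-- A monomial whose factors contain those of `w`, up to a renaming, is obtained from `w` by a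
monomial operator, up to the order of the factors. Left multiplications come before right ones,
since right multiplication of a generator makes it a left factor. -/
lemma exists_isMonomialOperator {w w' : FreeMagma Var} {ρ : ℕ → ℕ} (hρ : StrictMono ρ)
    (h1 : (factors w).1.map (shift ρ) ≤ (factors w').1)
    (h2 : (factors w).2.map (shift ρ) ≤ (factors w').2) :
    ∃ t, IsMonomialOperator t ∧ factors (t w) = factors w' := by
  obtain ⟨l, hl⟩ := Multiset.le_iff_exists_add.1 h1
  obtain ⟨r, hr⟩ := Multiset.le_iff_exists_add.1 h2
  have hmap := (factors_map (shift ρ) w).1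
  obtain ⟨t, ht, htw, hleft⟩ := (IsMonomialOperator.map ρ hρ).exists_add_left w l
  rw [hmap] at htw
  by_cases hr0 : r = 0
  · refine ⟨t, ht, ?_⟩
    rw [htw]
    ext1 <;> simp [hl, hr, hr0, add_comm]
  -- A generator and a further right factor can only come with a left factor.
  have hcond : l ≠ 0 ∨ leftFactors (FreeMagma.map (shift ρ) w) =
      factors (FreeMagma.map (shift ρ) w) := by
    induction w with
    | ih2 u v _ _ =>
      rw [map_mul]
      exact .inr rfl
    | ih1 x =>
      left
      rintro rfl
      induction w' with
      | ih1 y =>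
        have := congrArg Multiset.card hr
        simp [factors_of, hr0] at this
      | ih2 u v _ _ =>
        have := card_leftFactors_fst_pos (u * v)
        rw [leftFactors_mul, hl] at this
        simp [factors_of] at this
  obtain ⟨t', ht', htw', -⟩ := ht.exists_add_right (hleft hcond) r
  refine ⟨t', ht', ?_⟩
  rw [htw', htw]
  ext1 <;> simp [hl, hr, add_comm]

variable {K : Type u} [Field K]

/-! ### Identities of a class of superalgebras -/

/-- A substitution of elements of `A` for the variables which respects parities. -/
def IsGraded (A : Superalgebra.{u, v} K) (φ : Var → A.carrier) : Prop :=
  ∀ x : Var, φ x ∈ A.component x.1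

/-- The coefficient vectors of the super-polynomials that vanish on every member of `V`. -/
def identities (V : Set (Superalgebra.{u, v} K)) : Submodule K (FreeMagma Var →₀ K) where
  carrier := {f | ∀ A ∈ V, ∀ φ, A.IsGraded φ → Finsupp.linearCombination K (FreeMagma.lift φ) f = 0}
  zero_mem' := fun _ _ _ _ => map_zero _
  add_mem' := fun hf hg A hA φ hφ => by rw [map_add, hf A hA φ hφ, hg A hA φ hφ, add_zero]
  smul_mem' := fun c f hf A hA φ hφ => by rw [map_smul, hf A hA φ hφ, smul_zero]

lemma identities_anti {V W : Set (Superalgebra.{u, v} K)} (h : V ⊆ W) :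
    identities W ≤ identities V := fun _ hf A hA => hf A (h hA)

lemma mem_identities_iff {V : Set (Superalgebra.{u, v} K)} {f : SuperPoly K} :
    f.coeff ∈ identities V ↔ ∀ A ∈ V, A.Satisfies f := Iff.rfl

lemma IsMonomialOperator.mapDomain_mem {t : FreeMagma Var → FreeMagma Var}
    (ht : IsMonomialOperator t) {V : Set (Superalgebra.{u, v} K)} {f : FreeMagma Var →₀ K}
    (hf : f ∈ identities V) : f.mapDomain t ∈ identities V := by
  intro A hA
  induction ht with
  | map ρ hρ =>
    intro φ hφ
    have h : FreeMagma.lift φ ∘ FreeMagma.map (shift ρ) = FreeMagma.lift (φ ∘ shift ρ) := by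
      have : (FreeMagma.lift φ).comp (FreeMagma.map (shift ρ)) = FreeMagma.lift (φ ∘ shift ρ) := by
        ext x
        simp
      rw [← this]
      rfl
    rw [Finsupp.linearCombination_mapDomain, h]
    exact hf A hA _ fun x => hφ (shift ρ x)
  | @mul_left x t ht ih =>
    intro φ hφ
    have h := congrArg (LinearMap.mulLeft K (φ x)) (ih φ hφ)
    rw [Finsupp.linearCombination_mapDomain, map_zero, Finsupp.apply_linearCombination] at h
    rw [Finsupp.linearCombination_mapDomain, ← h]
    congr 2
  | @mul_right x t ht ih =>
    intro φ hφ
    have h := congrArg (LinearMap.mulRight K (φ x)) (ih φ hφ)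
    rw [Finsupp.linearCombination_mapDomain, map_zero, Finsupp.apply_linearCombination] at h
    rw [Finsupp.linearCombination_mapDomain, ← h]
    congr 2

/-! ### Monomials up to sign -/

lemma exists_lift_mem_component (w : FreeMagma Var) :
    ∃ i, ∀ (A : Superalgebra.{u, v} K) (φ : Var → A.carrier), A.IsGraded φ →
      FreeMagma.lift φ w ∈ A.component i := by
  induction w with
  | ih1 x => exact ⟨x.1, fun A φ hφ => hφ x⟩
  | ih2 u v ihu ihv =>
    obtain ⟨i, hi⟩ := ihu
    obtain ⟨j, hj⟩ := ihv
    exact ⟨i + j, fun A φ hφ => by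
      rw [map_mul]
      exact A.mul_mem (hi A φ hφ) (hj A φ hφ)⟩

variable (K) in
/-- The congruence that identifies two monomials if they agree, up to a sign independent of the
algebra and of the substitution, in all bicommutative superalgebras. A sign is encoded as a scalar
of square `1`. -/
def signCon : Con (FreeMagma Var) where
  r w w' := ∃ ε : K, ε * ε = 1 ∧ ∀ A ∈ bicommutative.{u, v} K, ∀ φ, A.IsGraded φ →
    FreeMagma.lift φ w = ε • FreeMagma.lift φ w'
  iseqv :=
    { refl := fun w => ⟨1, one_mul 1, fun _ _ _ _ => (one_smul ..).symm⟩
      symm := fun ⟨ε, hε, h⟩ =>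
        ⟨ε, hε, fun A hA φ hφ => by rw [h A hA φ hφ, smul_smul, hε, one_smul]⟩
      trans := fun ⟨ε, hε, h⟩ ⟨δ, hδ, h'⟩ =>
        ⟨ε * δ, by rw [mul_mul_mul_comm, hε, hδ, one_mul], fun A hA φ hφ => by
          rw [h A hA φ hφ, h' A hA φ hφ, smul_smul]⟩ }
  mul' := fun ⟨ε, hε, h⟩ ⟨δ, hδ, h'⟩ =>
    ⟨ε * δ, by rw [mul_mul_mul_comm, hε, hδ, one_mul], fun A hA φ hφ => by
      rw [map_mul, map_mul, h A hA φ hφ, h' A hA φ hφ, smul_mul_smul_comm]⟩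

lemma neg_one_pow_mul_self (n : ℕ) : (-1 : K) ^ n * (-1) ^ n = 1 := by
  rw [← mul_pow, neg_one_mul, neg_neg, one_pow]

instance : BicommutativeMagma (signCon.{u, v} K).Quotient where
  left_comm a b c := by
    induction a, b using Con.induction_on₂ with
    | H a b =>
      induction c using Con.induction_on with
      | H c =>
        obtain ⟨i, hi⟩ := exists_lift_mem_component.{u, v} (K := K) a
        obtain ⟨j, hj⟩ := exists_lift_mem_component.{u, v} (K := K) b
        obtain ⟨k, hk⟩ := exists_lift_mem_component.{u, v} (K := K) c
        refine (Con.eq _).2 ⟨(-1) ^ (i.val * j.val), neg_one_pow_mul_self _, fun A hA φ hφ => ?_⟩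
        simp only [map_mul]
        exact (hA i j k _ _ _ (hi A φ hφ) (hj A φ hφ) (hk A φ hφ)).1
  right_comm a b c := by
    induction a, b using Con.induction_on₂ with
    | H a b =>
      induction c using Con.induction_on with
      | H c =>
        obtain ⟨i, hi⟩ := exists_lift_mem_component.{u, v} (K := K) a
        obtain ⟨j, hj⟩ := exists_lift_mem_component.{u, v} (K := K) b
        obtain ⟨k, hk⟩ := exists_lift_mem_component.{u, v} (K := K) c
        refine (Con.eq _).2 ⟨(-1) ^ (j.val * k.val), neg_one_pow_mul_self _, fun A hA φ hφ => ?_⟩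
        simp only [map_mul]
        exact (hA i j k _ _ _ (hi A φ hφ) (hj A φ hφ) (hk A φ hφ)).2

lemma signCon_of_factors_eq {w w' : FreeMagma Var} (h : factors w = factors w') :
    signCon.{u, v} K w w' :=
  (Con.eq _).1 <| map_eq_of_factors_eq
    (e := { toFun := fun w => (w : (signCon.{u, v} K).Quotient), map_mul' := fun _ _ => rfl }) h

/-! ### Reduction to linear combinations of normal monomials -/

/-- The weights of monomials. They index the monomials modulo `signCon`. -/
abbrev MonomialWeight : Type := Set.range fun w : FreeMagma Var => weight (factors w)

/-- The weight of a monomial. -/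
noncomputable def monomialWeight (w : FreeMagma Var) : MonomialWeight :=
  ⟨weight (factors w), w, rfl⟩

/-- A monomial of given weight. -/
noncomputable def representative (n : MonomialWeight) : FreeMagma Var := n.2.choose

lemma monomialWeight_representative (n : MonomialWeight) :
    monomialWeight (representative n) = n := Subtype.ext n.2.choose_spec

lemma monomialWeight_eq_iff {w w' : FreeMagma Var} :
    monomialWeight w = monomialWeight w' ↔ factors w = factors w' :=
  Subtype.ext_iff.trans weight_injective.eq_iff

lemma exists_single_sub_mem (w : FreeMagma Var) :
    ∃ c : K, c ≠ 0 ∧ ∀ a : K, Finsupp.single w a -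
      Finsupp.single (representative (monomialWeight w)) (a * c) ∈
        identities (bicommutative.{u, v} K) := by
  obtain ⟨ε, hε, h⟩ := signCon_of_factors_eq.{u, v} (K := K)
    (monomialWeight_eq_iff.1 (monomialWeight_representative (monomialWeight w))).symm
  refine ⟨ε, left_ne_zero_of_mul_eq_one hε, fun a A hA φ hφ => ?_⟩
  simp [h A hA φ hφ, smul_smul, -Finsupp.single_mul]

lemma exists_sub_mapDomain_mem (f : FreeMagma Var →₀ K) :
    ∃ g : MonomialWeight →₀ K,
      f - g.mapDomain representative ∈ identities (bicommutative.{u, v} K) := by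
  induction f using Finsupp.induction_linear with
  | zero => exact ⟨0, by simp⟩
  | add f f' hf hf' =>
    obtain ⟨g, hg⟩ := hf
    obtain ⟨g', hg'⟩ := hf'
    refine ⟨g + g', ?_⟩
    rw [Finsupp.mapDomain_add, add_sub_add_comm]
    exact add_mem hg hg'
  | single w a =>
    obtain ⟨c, -, h⟩ := exists_single_sub_mem.{u, v} (K := K) w
    exact ⟨Finsupp.single (monomialWeight w) (a * c), by simpa [-Finsupp.single_mul] using h a⟩

/-- The combinations of normal monomials that vanish on every member of `V`. -/
noncomputable def normalIdentities (V : Set (Superalgebra.{u, v} K)) :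
    Submodule K (MonomialWeight →₀ K) :=
  (identities V).comap (Finsupp.lmapDomain K K representative)

lemma mem_normalIdentities {V : Set (Superalgebra.{u, v} K)} {g : MonomialWeight →₀ K} :
    g ∈ normalIdentities V ↔ g.mapDomain representative ∈ identities V := Iff.rfl

variable (K) in
/-- The monomial maps, with nonzero coefficients and strictly monotone on weights, under which the
identities of all classes of bicommutative superalgebras are stable. -/
def stableMaps : Set ((MonomialWeight → MonomialWeight) × (MonomialWeight → K)) :=
  {T | StrictMono T.1 ∧ (∀ n, T.2 n ≠ 0) ∧ ∀ V ⊆ bicommutative.{u, v} K,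
    ∀ f ∈ normalIdentities V, monomialMap T.1 T.2 f ∈ normalIdentities V}

lemma IsMonomialOperator.exists_stableMap {t : FreeMagma Var → FreeMagma Var}
    (ht : IsMonomialOperator t) :
    ∃ c, ((fun n => monomialWeight (t (representative n))), c) ∈ stableMaps.{u, v} K := by
  choose c hc hsub using fun n => exists_single_sub_mem.{u, v} (K := K) (t (representative n))
  refine ⟨c, fun m n hmn => ?_, hc, fun V hV f hf => ?_⟩
  · apply ht.weight_lt
    change monomialWeight _ < monomialWeight _
    rwa [monomialWeight_representative, monomialWeight_representative]
  · have key : ∀ f : MonomialWeight →₀ K, (f.mapDomain representative).mapDomain t -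
        (monomialMap (fun n => monomialWeight (t (representative n))) c f).mapDomain
          representative ∈ identities (bicommutative.{u, v} K) := by
      intro f
      induction f using Finsupp.induction_linear with
      | zero => simp
      | add f f' hf hf' =>
        rw [map_add, Finsupp.mapDomain_add, Finsupp.mapDomain_add, Finsupp.mapDomain_add,
          add_sub_add_comm]
        exact add_mem hf hf'
      | single n a => simpa [monomialMap_single, -Finsupp.single_mul] using hsub n a
    have h := sub_mem (ht.mapDomain_mem (mem_normalIdentities.1 hf)) (identities_anti hV (key f))
    rwa [sub_sub_cancel] at h

lemma wellQuasiOrdered_stableMaps :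
    WellQuasiOrdered fun m n => ∃ T ∈ stableMaps.{u, v} K, T.1 m = n := by
  intro s
  obtain ⟨m, n, hmn, ρ, hρ, h1, h2⟩ :=
    wellQuasiOrdered_shift fun k => factors (representative (s k))
  obtain ⟨t, ht, h⟩ := exists_isMonomialOperator hρ h1 h2
  obtain ⟨c, hc⟩ := ht.exists_stableMap (K := K)
  refine ⟨m, n, hmn, _, hc, ?_⟩
  rw [← monomialWeight_representative (s n)]
  exact monomialWeight_eq_iff.2 h

/-! ### Finite bases of identities -/

variable (K) in
/-- The super-polynomial of super-left-commutativity for variables of parities `p`. -/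
noncomputable def leftCommPoly (p : ZMod 2 × ZMod 2 × ZMod 2) : SuperPoly K :=
  let x := FreeNonUnitalNonAssocAlgebra.of K ((p.1, 0) : Var)
  let y := FreeNonUnitalNonAssocAlgebra.of K ((p.2.1, 1) : Var)
  let z := FreeNonUnitalNonAssocAlgebra.of K ((p.2.2, 2) : Var)
  x * (y * z) - (-1 : K) ^ (p.1.val * p.2.1.val) • (y * (x * z))

variable (K) in
/-- The super-polynomial of super-right-commutativity for variables of parities `p`. -/
noncomputable def rightCommPoly (p : ZMod 2 × ZMod 2 × ZMod 2) : SuperPoly K :=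
  let x := FreeNonUnitalNonAssocAlgebra.of K ((p.1, 0) : Var)
  let y := FreeNonUnitalNonAssocAlgebra.of K ((p.2.1, 1) : Var)
  let z := FreeNonUnitalNonAssocAlgebra.of K ((p.2.2, 2) : Var)
  (x * y) * z - (-1 : K) ^ (p.2.1.val * p.2.2.val) • ((x * z) * y)

theorem bicommutative_eq_definedBy : bicommutative.{u, v} K =
    definedBy (Set.range (leftCommPoly K) ∪ Set.range (rightCommPoly K)) := by
  classical
  ext A
  constructor
  · rintro hA f (⟨p, rfl⟩ | ⟨p, rfl⟩) φ hφ
    · simpa [leftCommPoly, sub_eq_zero] using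
        (hA _ _ _ _ _ _ (hφ (p.1, 0)) (hφ (p.2.1, 1)) (hφ (p.2.2, 2))).1
    · simpa [rightCommPoly, sub_eq_zero] using
        (hA _ _ _ _ _ _ (hφ (p.1, 0)) (hφ (p.2.1, 1)) (hφ (p.2.2, 2))).2
  · intro hA i j k a b c ha hb hc
    let φ : Var → A.carrier := fun x =>
      if x = (i, 0) then a else if x = (j, 1) then b else if x = (k, 2) then c else 0
    have hφ : ∀ x : Var, φ x ∈ A.component x.1 := by
      intro x
      simp only [φ]
      split_ifs with h1 h2 h3
      · rwa [h1]
      · rwa [h2]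
      · rwa [h3]
      · exact zero_mem _
    have h1 := hA _ (.inl ⟨(i, j, k), rfl⟩) φ hφ
    have h2 := hA _ (.inr ⟨(i, j, k), rfl⟩) φ hφ
    simp only [leftCommPoly, rightCommPoly, map_sub, map_smul, map_mul,
      FreeNonUnitalNonAssocAlgebra.lift_of_apply, sub_eq_zero] at h1 h2
    exact ⟨by simpa [φ] using h1, by simpa [φ] using h2⟩

end Superalgebra

theorem theorem5p6 {K : Type u} [Field K] (hK : ringChar K ≠ 2)
    (V : Set (Superalgebra.{u, v} K)) (hV : Superalgebra.IsVariety V)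
    (hVB : V ⊆ Superalgebra.bicommutative K) :
    Superalgebra.IsFinitelyBased V := by
  open Superalgebra in
  obtain ⟨S, rfl⟩ := hV
  obtain ⟨G, hGfin, hGV, hG⟩ := exists_finite_generating (stableMaps.{u, v} K)
    (fun T hT => hT.1) (fun T hT => hT.2.1) wellQuasiOrdered_stableMaps
    (normalIdentities (definedBy S)) fun T hT => hT.2.2 _ hVB
  let toPoly : (MonomialWeight →₀ K) → SuperPoly K := fun g => .ofCoeff (g.mapDomain representative)
  -- The identities of `W` form a stable subspace that contains `G`, hence all identities of `V`.
  let W : Set (Superalgebra.{u, v} K) :=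
    definedBy ((Set.range (leftCommPoly K) ∪ Set.range (rightCommPoly K)) ∪ toPoly '' G)
  have hWB : W ⊆ bicommutative K := by
    rw [bicommutative_eq_definedBy]
    exact fun A hA f hf => hA f (.inl hf)
  refine ⟨_, ((Set.finite_range _).union (Set.finite_range _)).union (hGfin.image toPoly),
    Set.Subset.antisymm (fun A hA => ?_) (show W ⊆ _ from fun A hA f hf => ?_)⟩
  · rintro f (hf | ⟨g, hg, rfl⟩)
    · have hAB := hVB hA
      rw [bicommutative_eq_definedBy] at hAB
      exact hAB f hf
    · exact hGV hg A hA
  · have hGW : normalIdentities (definedBy S) ≤ normalIdentities W := by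
      refine hG _ (fun T hT => hT.2.2 _ hWB) fun g hg B hB => hB (toPoly g) (.inr ⟨g, hg, rfl⟩)
    have hfS : f.coeff ∈ identities (definedBy.{u, v} S) := fun B hB => hB f hf
    obtain ⟨g, hg⟩ := exists_sub_mapDomain_mem.{u, v} f.coeff
    have hgS : g ∈ normalIdentities (definedBy.{u, v} S) := by
      have := sub_mem hfS (identities_anti hVB hg)
      rwa [sub_sub_cancel] at this
    have hfW : f.coeff ∈ identities W := by
      have := add_mem (identities_anti hWB hg) (mem_normalIdentities.1 (hGW hgS))
      rwa [sub_add_cancel] at this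
    exact mem_identities_iff.1 hfW A hA
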